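/- Let $n\in\mathbb{N}$, and let $\mathrm{RH}_\infty^{n\times n}$ denote the set of $n\times n$ matrices of real rational functions that are proper and have no poles in the closed right half-plane $\{s\in\mathbb{C} : \operatorname{Re} s\ge 0\}$. For $\Phi\in \mathrm{RH}_\infty^{n\times n}$ write $\Phi(j\infty):=\lim_{\omega\to\infty}\Phi(j\omega)$, and let $\preceq$ denote the Loewner order on Hermitian matrices. **Theorem.** Let $G,K\in\mathrm{RH}_\infty^{n\times n}$ be such that for all invertible $T,S\in\mathbb{R}^{n\times n}$ the rational matrix $I+T^{T}GT\,S^{T}KS$ is invertible and $(I+T^{T}GT\,S^{T}KS)^{-1}\in\mathrm{RH}_\infty^{n\times n}$. Then there is an $\epsilon>0$ such that, for each $\omega\in\{0,\infty\}$ with $G(j\omega)\neq 0$ and $K(j\omega)\neq 0$, there is a matrix $$\Pi(j\omega)\in\left\{\begin{bmatrix}0&I\\ I&0\end{bmatrix},\ -\begin{bmatrix}0&I\\ I&0\end{bmatrix}\right\}$$ for which either $$\begin{pmatrix} I & -G(j\omega)^*\end{pmatrix}\Pi(j\omega)\begin{pmatrix} I\\ -G(j\omega)\end{pmatrix}\preceq-\epsilon\,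 G(j\omega)^*G(j\omega)\quad\text{and}\quad \begin{pmatrix} K(j\omega)^* & I\end{pmatrix}\Pi(j\omega)\begin{pmatrix} K(j\omega)\\ I\end{pmatrix}\succeq 0,$$ or $$\begin{pmatrix} I & -G(j\omega)^*\end{pmatrix}\Pi(j\omega)\begin{pmatrix} I\\ -G(j\omega)\end{pmatrix}\preceq 0\quad\text{and}\quad \begin{pmatrix} K(j\omega)^* & I\end{pmatrix}\Pi(j\omega)\begin{pmatrix} K(j\omega)\\ I\end{pmatrix}\succeq \epsilon\, K(j\omega)^*K(j\omega).$$ -/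

import Mathlib

open scoped ENNReal ComplexOrder

noncomputable section

namespace PhaseMultiplier

/-- Membership of a matrix of real rational functions in `RH∞`: every entry is proper and has no
pole in the closed right half-plane (`denom` is the denominator in lowest terms). -/
def IsRHInf {m n : Type*} (G : Matrix m n (RatFunc ℝ)) : Prop :=
  ∀ i j, (G i j).num.degree ≤ (G i j).denom.degree ∧
    ∀ s : ℂ, 0 ≤ s.re → Polynomial.aeval s (G i j).denom ≠ 0

/-- `M⁻¹ ∈ RH∞`: the rational matrix `M` is invertible over the field of real rational functions,
and its inverse lies in `RH∞`. -/
def HasRHInfInverse {n : Type*} [Fintype n] [DecidableEq n] (M : Matrix n n (RatFunc ℝ)) : Prop :=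
  IsUnit M ∧ IsRHInf M⁻¹

/-- A constant real matrix, seen as a (static) transfer function matrix. -/
def static {m n : Type*} (T : Matrix m n ℝ) : Matrix m n (RatFunc ℝ) :=
  T.map RatFunc.C

/-- The value `f(jω)`, `ω ∈ [0, ∞]`, of a proper real rational function. For `ω = ∞` it is the
quotient of the coefficients of numerator and denominator at the degree of the denominator, which
is the limit of `f(jω)` as `ω → ∞` (see `tendsto_scalarAt_top`). -/
def scalarAt (f : RatFunc ℝ) (ω : ℝ≥0∞) : ℂ :=
  if ω = ∞ then ((f.num.coeff f.denom.natDegree / f.denom.coeff f.denom.natDegree : ℝ) : ℂ)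
  else f.eval (algebraMap ℝ ℂ) (Complex.I * (ω.toReal : ℂ))

/-- The value `G(jω)`, `ω ∈ [0, ∞]`, of a proper real rational transfer function matrix. -/
def valueAt {m n : Type*} (G : Matrix m n (RatFunc ℝ)) (ω : ℝ≥0∞) : Matrix m n ℂ :=
  G.map fun f => scalarAt f ω

/-- `X ⪯ Y` in the Loewner order (the difference `Y - X` is Hermitian positive semidefinite). -/
def LoewnerLE {n : Type*} (X Y : Matrix n n ℂ) : Prop :=
  (Y - X).PosSemidef

/-- The matrix `(I  -A*) P (I ; -A)`. -/
def graphForm {n : Type*} [Fintype n] [DecidableEq n]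
    (P : Matrix (n ⊕ n) (n ⊕ n) ℂ) (A : Matrix n n ℂ) : Matrix n n ℂ :=
  (Matrix.fromCols 1 (-A.conjTranspose) : Matrix n (n ⊕ n) ℂ) * P *
    (Matrix.fromRows 1 (-A) : Matrix (n ⊕ n) n ℂ)

/-- The matrix `(B*  I) P (B ; I)`. -/
def inverseGraphForm {n : Type*} [Fintype n] [DecidableEq n]
    (P : Matrix (n ⊕ n) (n ⊕ n) ℂ) (B : Matrix n n ℂ) : Matrix n n ℂ :=
  (Matrix.fromCols B.conjTranspose 1 : Matrix n (n ⊕ n) ℂ) * P *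
    (Matrix.fromRows B 1 : Matrix (n ⊕ n) n ℂ)

/-- The multiplier `[0 I; I 0]`. -/
def passivityMultiplier (n : Type*) [DecidableEq n] : Matrix (n ⊕ n) (n ⊕ n) ℂ :=
  Matrix.fromBlocks 0 1 1 0

open Filter Topology in
/-- The value at `ω = ∞` of a proper rational function is the limit of the values `f(jω)`. -/
theorem tendsto_scalarAt_top (f : RatFunc ℝ) (hf : f.num.degree ≤ f.denom.degree) :
    Tendsto (fun ω : ℝ => f.eval (algebraMap ℝ ℂ) (Complex.I * (ω : ℂ))) atTop
      (𝓝 (scalarAt f ∞)) := by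
  set d := f.denom.natDegree with hd
  have hnum : f.num.natDegree ≤ d := Polynomial.natDegree_le_natDegree hf
  have key : ∀ p : Polynomial ℝ, p.natDegree ≤ d → ∀ s : ℂ, s ≠ 0 →
      p.eval₂ (algebraMap ℝ ℂ) s = (p.reflect d).eval₂ (algebraMap ℝ ℂ) s⁻¹ * s ^ d := by
    intro p hp s hs
    let _ : Invertible s := invertibleOfNonzero hs
    have := Polynomial.eval₂_reflect_mul_pow (algebraMap ℝ ℂ) s d p hp
    rw [← this, invOf_eq_inv]
  have hinv : Tendsto (fun ω : ℝ => (Complex.I * (ω : ℂ))⁻¹) atTop (𝓝 0) := by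
    rw [tendsto_zero_iff_norm_tendsto_zero]
    have h : (fun ω : ℝ => ‖(Complex.I * (ω : ℂ))⁻¹‖) = fun ω : ℝ => |ω|⁻¹ := by
      funext ω; simp
    rw [h]
    exact tendsto_inv_atTop_zero.comp tendsto_abs_atTop_atTop
  have hlim : ∀ p : Polynomial ℝ,
      Tendsto (fun ω : ℝ => (p.reflect d).eval₂ (algebraMap ℝ ℂ) (Complex.I * (ω : ℂ))⁻¹) atTop
        (𝓝 ((p.coeff d : ℝ) : ℂ)) := by
    intro p
    have hc : Continuous fun z : ℂ => (p.reflect d).eval₂ (algebraMap ℝ ℂ) z :=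
      (p.reflect d).continuous_eval₂ _
    have h0 : (p.reflect d).eval₂ (algebraMap ℝ ℂ) 0 = ((p.coeff d : ℝ) : ℂ) := by
      rw [Polynomial.eval₂_at_zero, Polynomial.coeff_reflect]
      simp
    rw [← h0]
    exact (hc.tendsto 0).comp hinv
  have hden : ((f.denom.coeff d : ℝ) : ℂ) ≠ 0 := by
    rw [hd, Polynomial.coeff_natDegree, (RatFunc.monic_denom f).leadingCoeff]
    simp
  have hval : scalarAt f ∞ = ((f.num.coeff d : ℝ) : ℂ) / ((f.denom.coeff d : ℝ) : ℂ) := by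
    simp [scalarAt, hd]
  rw [hval]
  refine ((hlim f.num).div (hlim f.denom) hden).congr' ?_
  filter_upwards [eventually_gt_atTop (0 : ℝ)] with ω hω
  have hs : Complex.I * (ω : ℂ) ≠ 0 :=
    mul_ne_zero Complex.I_ne_zero (by exact_mod_cast hω.ne')
  rw [RatFunc.eval, key _ hnum _ hs, key _ le_rfl _ hs,
    mul_div_mul_right _ _ (pow_ne_zero d hs)]
  rfl

end PhaseMultiplier

end

/-!
The stability of all the scaled loops is used only through the values `A = G(jω)` and `B = K(jω)`,
which are real matrices at `ω = 0` and `ω = ∞`. Passing to the limit in the product of the return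
difference with its inverse shows that `1 + A U B Uᵀ` is invertible for every invertible real `U`
(`isUnit_one_add_of_stable`).

An invertible `U` with `Uᵀ x = w` and `U z = y` exists for nonzero vectors as soon as
`x ⬝ᵥ y = w ⬝ᵥ z` (`exists_isUnit_transpose_mulVec_eq`). With `x = -A y` and `z = B w` such a `U`
makes `x` a null vector of `1 + A U B Uᵀ`, and the pairing condition reads
`y ⬝ᵥ A y + w ⬝ᵥ B w = 0`. Hence this sum is nonzero whenever `A y ≠ 0` and `B w ≠ 0`
(`add_dotProduct_mulVec_ne_zero`). Rescaling `y` and `w` then forces the two quadratic forms to be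
semidefinite of the same sign, and one of them to vanish only on the kernel of its matrix
(`forms_semidefinite`); the common sign selects the multiplier.

Finally, a nonnegative form `A` that vanishes only on `ker A` satisfies `A + Aᵀ ⪰ ε Aᵀ A` for all
small `ε` (`exists_posSemidef_sub`), which is the strict inequality sought. The smaller of the two
margins found at `0` and at `∞` serves both frequencies.
-/

namespace PhaseMultiplier

open Matrix Filter Topology

/-! ### Transvections with prescribed action on a vector and a covector -/

section Transvection

variable {n : Type*} [Fintype n]

lemma exists_dotProduct_eq_one_and_ne_zero {p y : n → ℝ} (hp : p ≠ 0) (hy : y ≠ 0) :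
    ∃ h : n → ℝ, h ⬝ᵥ p = 1 ∧ h ⬝ᵥ y ≠ 0 := by
  have pos : ∀ v : n → ℝ, v ≠ 0 → 0 < v ⬝ᵥ v := fun v hv => by
    simpa using dotProduct_star_self_pos_iff.2 hv
  suffices H : ∃ h : n → ℝ, h ⬝ᵥ p ≠ 0 ∧ h ⬝ᵥ y ≠ 0 by
    obtain ⟨h, h1, h2⟩ := H
    refine ⟨(h ⬝ᵥ p)⁻¹ • h, ?_, ?_⟩
    · rw [smul_dotProduct, smul_eq_mul, inv_mul_cancel₀ h1]
    · rw [smul_dotProduct, smul_eq_mul]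
      exact mul_ne_zero (inv_ne_zero h1) h2
  by_cases hpy : p ⬝ᵥ y = 0
  · refine ⟨p + y, ?_, ?_⟩
    · rw [add_dotProduct, dotProduct_comm y p, hpy, add_zero]
      exact (pos p hp).ne'
    · rw [add_dotProduct, hpy, zero_add]
      exact (pos y hy).ne'
  · exact ⟨p, (pos p hp).ne', hpy⟩

variable [DecidableEq n]

/-- A nonzero vector `p` is carried to any nonzero vector `y` by an invertible rank-one
perturbation of the identity in the direction `y - p`; such a map fixes every covector that
takes the same value at `p` and `y`. -/
lemma exists_isUnit_one_add_vecMulVec {p y : n → ℝ} (hp : p ≠ 0) (hy : y ≠ 0) :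
    ∃ h : n → ℝ, IsUnit (1 + vecMulVec (y - p) h) ∧ (1 + vecMulVec (y - p) h) *ᵥ p = y := by
  obtain ⟨h, h1, h2⟩ := exists_dotProduct_eq_one_and_ne_zero hp hy
  refine ⟨h, ?_, ?_⟩
  · rw [isUnit_iff_isUnit_det, vecMulVec_eq Unit, det_one_add_replicateCol_mul_replicateRow,
      dotProduct_sub, h1]
    simpa using h2
  · rw [add_mulVec, one_mulVec, vecMulVec_mulVec, h1]
    simp

/-- The pairing condition `x ⬝ᵥ y = w ⬝ᵥ z`, which is plainly necessary, is the only obstruction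
to finding an invertible `U` with `Uᵀ x = w` and `U z = y`, for nonzero vectors. -/
lemma exists_isUnit_transpose_mulVec_eq {x w z y : n → ℝ} (hx : x ≠ 0) (hw : w ≠ 0)
    (hz : z ≠ 0) (hy : y ≠ 0) (h : x ⬝ᵥ y = w ⬝ᵥ z) :
    ∃ U : Matrix n n ℝ, IsUnit U ∧ Uᵀ *ᵥ x = w ∧ U *ᵥ z = y := by
  obtain ⟨k, hk, hkx⟩ := exists_isUnit_one_add_vecMulVec hx hw
  set E := 1 + vecMulVec (w - x) k
  have hEz : Eᵀ *ᵥ z ≠ 0 := fun h0 =>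
    hz (mulVec_injective_of_isUnit ((isUnit_transpose E).2 hk) (by rw [h0, mulVec_zero]))
  obtain ⟨l, hl, hlp⟩ := exists_isUnit_one_add_vecMulVec hEz hy
  refine ⟨(1 + vecMulVec (y - Eᵀ *ᵥ z) l) * Eᵀ, hl.mul ((isUnit_transpose E).2 hk), ?_, ?_⟩
  · -- The correction of `Eᵀ z` to `y` is orthogonal to `x`, so it does not disturb `Uᵀ x`.
    have hfix : (y - Eᵀ *ᵥ z) ⬝ᵥ x = 0 := by
      rw [sub_dotProduct, mulVec_transpose, ← dotProduct_mulVec, hkx, dotProduct_comm y,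
        dotProduct_comm z, h, sub_self]
    rw [transpose_mul, transpose_transpose, ← mulVec_mulVec, transpose_add, transpose_one,
      transpose_vecMulVec, add_mulVec 1 (vecMulVec l _), one_mulVec, vecMulVec_mulVec l, hfix]
    simpa using hkx
  · rw [← mulVec_mulVec, hlp]

end Transvection

/-! ### From nonsingular return differences to definite quadratic forms -/

section QuadraticForm

variable {n : Type*} [Fintype n]

/-- If the forms of `A` and `B` had opposite values at `y` and `w`, then `A y` would be a null
vector of `1 + A U B Uᵀ` for a `U` with `Uᵀ (-A y) = w` and `U (B w) = y`. -/
lemma add_dotProduct_mulVec_ne_zero [DecidableEq n] {A B : Matrix n n ℝ}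
    (h : ∀ U : Matrix n n ℝ, IsUnit U → IsUnit (1 + A * U * B * Uᵀ)) {y w : n → ℝ}
    (hy : A *ᵥ y ≠ 0) (hw : B *ᵥ w ≠ 0) : y ⬝ᵥ A *ᵥ y + w ⬝ᵥ B *ᵥ w ≠ 0 := by
  intro h0
  obtain ⟨U, hU, hUx, hUz⟩ := exists_isUnit_transpose_mulVec_eq (x := -(A *ᵥ y)) (w := w)
    (z := B *ᵥ w) (y := y) (neg_ne_zero.2 hy) (by rintro rfl; simp at hw) hw
    (by rintro rfl; simp at hy) (by rw [neg_dotProduct, dotProduct_comm]; linarith)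
  refine neg_ne_zero.2 hy (mulVec_injective_of_isUnit (h U hU) ?_)
  rw [mulVec_zero, add_mulVec, one_mulVec, ← mulVec_mulVec, ← mulVec_mulVec, ← mulVec_mulVec,
    hUx, hUz, neg_add_cancel]

/-- The quadratic form of `A` is nonnegative. -/
def FormNonneg (A : Matrix n n ℝ) : Prop := ∀ x, 0 ≤ x ⬝ᵥ A *ᵥ x

/-- The quadratic form of `A` is nonzero off the kernel of `A`. -/
def FormDefinite (A : Matrix n n ℝ) : Prop := ∀ x, x ⬝ᵥ A *ᵥ x = 0 → A *ᵥ x = 0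

/-- A form that takes both signs vanishes somewhere off the kernel of its matrix: on the line
through a positive and a negative vector it has two distinct zeros, and not both can lie in the
kernel. -/
lemma exists_form_eq_zero_of_pos_of_neg {A : Matrix n n ℝ} {y z : n → ℝ}
    (hy : 0 < y ⬝ᵥ A *ᵥ y) (hz : z ⬝ᵥ A *ᵥ z < 0) :
    ∃ x, x ⬝ᵥ A *ᵥ x = 0 ∧ A *ᵥ x ≠ 0 := by
  set a := y ⬝ᵥ A *ᵥ y with ha
  set b := z ⬝ᵥ A *ᵥ z with hb
  set c := y ⬝ᵥ A *ᵥ z + z ⬝ᵥ A *ᵥ y with hc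
  have hq : ∀ t : ℝ, (y + t • z) ⬝ᵥ A *ᵥ (y + t • z) = b * (t * t) + c * t + a := fun t => by
    simp only [mulVec_add, mulVec_smul, add_dotProduct, dotProduct_add, smul_dotProduct,
      dotProduct_smul, smul_eq_mul, ha, hb, hc]
    ring
  have hdisc : 0 < discrim b c a := by
    unfold discrim
    nlinarith [sq_nonneg c, mul_pos hy (neg_pos.2 hz)]
  set s := √(discrim b c a)
  have hs : 0 < s := Real.sqrt_pos.2 hdisc
  have hss : discrim b c a = s * s := (Real.mul_self_sqrt hdisc.le).symm
  have root := quadratic_eq_zero_iff hz.ne hss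
  by_contra! H
  have h1 := H _ ((hq ((-c + s) / (2 * b))).trans ((root _).2 (Or.inl rfl)))
  have h2 := H _ ((hq ((-c - s) / (2 * b))).trans ((root _).2 (Or.inr rfl)))
  have hne : (-c + s) / (2 * b) - (-c - s) / (2 * b) ≠ 0 := by
    rw [← sub_div]
    exact div_ne_zero (by linarith) (by linarith)
  have hAz : A *ᵥ z = 0 := by
    have h3 : ((-c + s) / (2 * b) - (-c - s) / (2 * b)) • A *ᵥ z = 0 := by
      rw [sub_smul, ← mulVec_smul, ← mulVec_smul, ← add_sub_add_left_eq_sub _ _ (A *ᵥ y),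
        ← mulVec_add, ← mulVec_add, h1, h2, sub_zero]
    exact (smul_eq_zero.1 h3).resolve_left hne
  rw [hb, hAz, dotProduct_zero] at hz
  exact hz.false

/-- Since values of a form can be rescaled by positive factors, values of strictly opposite signs
could be made to cancel. -/
lemma formNonneg_of_pos {A B : Matrix n n ℝ}
    (h : ∀ y w, A *ᵥ y ≠ 0 → B *ᵥ w ≠ 0 → y ⬝ᵥ A *ᵥ y + w ⬝ᵥ B *ᵥ w ≠ 0)
    {y : n → ℝ} (hy : 0 < y ⬝ᵥ A *ᵥ y) : FormNonneg B := by
  have hker : ∀ (M : Matrix n n ℝ) x, x ⬝ᵥ M *ᵥ x ≠ 0 → M *ᵥ x ≠ 0 := fun M x hx h0 =>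
    hx (by rw [h0, dotProduct_zero])
  intro w
  by_contra! hw
  set t := √(-(w ⬝ᵥ B *ᵥ w) / (y ⬝ᵥ A *ᵥ y))
  have ht : t * t = -(w ⬝ᵥ B *ᵥ w) / (y ⬝ᵥ A *ᵥ y) :=
    Real.mul_self_sqrt (div_nonneg (by linarith) hy.le)
  have hval : (t • y) ⬝ᵥ A *ᵥ (t • y) = -(w ⬝ᵥ B *ᵥ w) := by
    rw [mulVec_smul, smul_dotProduct, dotProduct_smul, smul_eq_mul, smul_eq_mul, ← mul_assoc,
      ht, div_mul_cancel₀ _ hy.ne']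
  refine h (t • y) w (hker A _ ?_) (hker B _ hw.ne) ?_
  · rw [hval]; linarith
  · rw [hval]; ring

lemma formNonneg_and_formNonneg_of_pos {A B : Matrix n n ℝ} (hB : B ≠ 0)
    (h : ∀ y w, A *ᵥ y ≠ 0 → B *ᵥ w ≠ 0 → y ⬝ᵥ A *ᵥ y + w ⬝ᵥ B *ᵥ w ≠ 0)
    {y : n → ℝ} (hy : 0 < y ⬝ᵥ A *ᵥ y) : FormNonneg A ∧ FormNonneg B := by
  classical
  have hBn := formNonneg_of_pos h hy
  refine ⟨?_, hBn⟩
  by_contra! H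
  simp only [FormNonneg, not_forall, not_le] at H
  obtain ⟨z, hz⟩ := H
  -- If the form of `A` takes both signs, its zero off the kernel forces that of `B` to be positive
  -- off the kernel, and a positive value of `B` rules out a negative value of `A`.
  obtain ⟨x, hx0, hAx⟩ := exists_form_eq_zero_of_pos_of_neg hy hz
  obtain ⟨w, hw⟩ : ∃ w, B *ᵥ w ≠ 0 := by
    by_contra! H
    exact hB (ext_of_mulVec_single fun i => by rw [H, zero_mulVec])
  have hwpos : 0 < w ⬝ᵥ B *ᵥ w :=
    (hBn w).lt_of_ne fun h0 => h x w hAx hw (by rw [hx0, ← h0, add_zero])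
  have hAn : FormNonneg A := formNonneg_of_pos
    (fun w y hw hy => by rw [add_comm]; exact h y w hy hw) hwpos
  exact hz.not_ge (hAn z)

/-- The two forms are semidefinite of the same sign, and at least one of them is definite modulo
the kernel of its matrix. -/
theorem forms_semidefinite {A B : Matrix n n ℝ} (hA : A ≠ 0) (hB : B ≠ 0)
    (h : ∀ y w, A *ᵥ y ≠ 0 → B *ᵥ w ≠ 0 → y ⬝ᵥ A *ᵥ y + w ⬝ᵥ B *ᵥ w ≠ 0) :
    ((FormNonneg A ∧ FormNonneg B) ∨ (FormNonneg (-A) ∧ FormNonneg (-B))) ∧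
      (FormDefinite A ∨ FormDefinite B) := by
  have hdef : FormDefinite A ∨ FormDefinite B := by
    by_contra! H
    simp only [FormDefinite, not_forall] at H
    obtain ⟨⟨y, hy, hAy⟩, w, hw, hBw⟩ := H
    exact h y w hAy hBw (by rw [hy, hw, add_zero])
  refine ⟨?_, hdef⟩
  by_cases hApos : ∃ y, 0 < y ⬝ᵥ A *ᵥ y
  · obtain ⟨y, hy⟩ := hApos
    exact Or.inl (formNonneg_and_formNonneg_of_pos hB h hy)
  by_cases hBpos : ∃ y, 0 < y ⬝ᵥ B *ᵥ y
  · obtain ⟨y, hy⟩ := hBpos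
    exact Or.inl (formNonneg_and_formNonneg_of_pos hA
      (fun w y hw hy => by rw [add_comm]; exact h y w hy hw) hy).symm
  push Not at hApos hBpos
  exact Or.inr ⟨fun x => by simpa [neg_mulVec] using hApos x, fun x => by simpa [neg_mulVec] using hBpos x⟩

end QuadraticForm

/-! ### Semidefinite matrix inequalities -/

section Loewner

variable {n : Type*} [Fintype n]

open scoped MatrixOrder in
lemma exists_eq_transpose_mul_self {H : Matrix n n ℝ} (hH : H.PosSemidef) :
    ∃ C : Matrix n n ℝ, H = Cᵀ * C := by
  classical
  obtain ⟨C, hC⟩ := CStarAlgebra.nonneg_iff_eq_star_mul_self.mp hH.nonneg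
  exact ⟨C, by simpa [star_eq_conjTranspose] using hC⟩

lemma posSemidef_map_ofReal {H : Matrix n n ℝ} (hH : H.PosSemidef) :
    (H.map Complex.ofReal).PosSemidef := by
  obtain ⟨C, rfl⟩ := exists_eq_transpose_mul_self hH
  have : (Cᵀ * C).map Complex.ofReal = (C.map Complex.ofReal)ᴴ * C.map Complex.ofReal := by
    ext i j
    simp [mul_apply]
  rw [this]
  exact posSemidef_conjTranspose_mul_self _

lemma posSemidef_sub_map_ofReal {A : Matrix n n ℝ} {ε : ℝ}
    (h : (A + Aᵀ - ε • (Aᵀ * A)).PosSemidef) :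
    (A.map Complex.ofReal + (A.map Complex.ofReal)ᴴ -
      ε • ((A.map Complex.ofReal)ᴴ * A.map Complex.ofReal)).PosSemidef := by
  convert posSemidef_map_ofReal h using 1
  ext i j
  simp [mul_apply]

lemma dotProduct_add_transpose_mulVec (A : Matrix n n ℝ) (x : n → ℝ) :
    x ⬝ᵥ (A + Aᵀ) *ᵥ x = 2 * (x ⬝ᵥ A *ᵥ x) := by
  rw [add_mulVec, dotProduct_add, mulVec_transpose, dotProduct_comm x (x ᵥ* A),
    ← dotProduct_mulVec, two_mul]

lemma FormNonneg.posSemidef {A : Matrix n n ℝ} (hA : FormNonneg A) : (A + Aᵀ).PosSemidef := by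
  refine .of_dotProduct_mulVec_nonneg ?_ fun x => ?_
  · simp [IsHermitian, conjTranspose_eq_transpose_of_trivial, add_comm]
  · rw [star_trivial, dotProduct_add_transpose_mulVec]
    exact mul_nonneg zero_le_two (hA x)

lemma exists_eq_mul_of_ker_le [DecidableEq n] {A C : Matrix n n ℝ}
    (h : ∀ x, C *ᵥ x = 0 → A *ᵥ x = 0) : ∃ D : Matrix n n ℝ, A = D * C := by
  obtain ⟨g, hg⟩ := C.toLin'.rangeRestrict.exists_rightInverse_of_surjective
    C.toLin'.range_rangeRestrict
  obtain ⟨g', hg'⟩ := g.exists_extend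
  refine ⟨A * LinearMap.toMatrix' g', ext_of_mulVec_single fun i => ?_⟩
  set x : n → ℝ := Pi.single i 1
  have h1 : C *ᵥ (g' (C *ᵥ x)) = C *ᵥ x := by
    have e1 : g' (C *ᵥ x) = g (C.toLin'.rangeRestrict x) :=
      LinearMap.congr_fun hg' (C.toLin'.rangeRestrict x)
    have e2 := congrArg Subtype.val (LinearMap.congr_fun hg (C.toLin'.rangeRestrict x))
    rw [e1]
    simpa using e2
  have h2 := h (x - g' (C *ᵥ x)) (by rw [mulVec_sub, h1, sub_self])
  rw [mulVec_sub, sub_eq_zero] at h2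
  rw [← mulVec_mulVec, ← mulVec_mulVec, LinearMap.toMatrix'_mulVec, h2]

lemma mulVec_dotProduct_self_le (D : Matrix n n ℝ) (v : n → ℝ) :
    (D *ᵥ v) ⬝ᵥ (D *ᵥ v) ≤ (∑ i, ∑ j, D i j ^ 2) * (v ⬝ᵥ v) := by
  have hv : v ⬝ᵥ v = ∑ j, v j ^ 2 := by simp [dotProduct, sq]
  rw [hv, Finset.sum_mul]
  refine Finset.sum_le_sum fun i _ => ?_
  rw [← sq]
  exact Finset.sum_mul_sq_le_sq_mul_sq _ _ _

/-- Writing `A + Aᵀ = Cᵀ C`, definiteness of the form says `ker C ≤ ker A`, so that `A = D C` and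
`Aᵀ A` is at most the squared Frobenius norm of `D` times `Cᵀ C`. -/
theorem exists_posSemidef_sub {A : Matrix n n ℝ} (hA : FormNonneg A) (hd : FormDefinite A) :
    ∃ ε₀ : ℝ, 0 < ε₀ ∧ ∀ ε, ε ≤ ε₀ → (A + Aᵀ - ε • (Aᵀ * A)).PosSemidef := by
  classical
  obtain ⟨C, hC⟩ := exists_eq_transpose_mul_self hA.posSemidef
  have hform : ∀ M : Matrix n n ℝ, ∀ x, x ⬝ᵥ (Mᵀ * M) *ᵥ x = (M *ᵥ x) ⬝ᵥ (M *ᵥ x) := fun M x => by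
    rw [← mulVec_mulVec, dotProduct_mulVec, vecMul_transpose]
  obtain ⟨D, hD⟩ : ∃ D : Matrix n n ℝ, A = D * C := by
    refine exists_eq_mul_of_ker_le fun x hx => hd x ?_
    have := dotProduct_add_transpose_mulVec A x
    rw [hC, hform, hx, dotProduct_zero] at this
    linarith
  set c := ∑ i, ∑ j, D i j ^ 2
  have hc : 0 ≤ c := Finset.sum_nonneg fun i _ => Finset.sum_nonneg fun j _ => sq_nonneg _
  -- The added `1` keeps the bound positive when `D = 0`.
  refine ⟨(c + 1)⁻¹, by positivity, fun ε hε => .of_dotProduct_mulVec_nonneg ?_ fun x => ?_⟩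
  · simp [IsHermitian, conjTranspose_eq_transpose_of_trivial, add_comm]
  · rw [star_trivial, sub_mulVec, dotProduct_sub, hC, hform, smul_mulVec, dotProduct_smul, hform,
      smul_eq_mul, sub_nonneg]
    have h1 : (A *ᵥ x) ⬝ᵥ (A *ᵥ x) ≤ c * ((C *ᵥ x) ⬝ᵥ (C *ᵥ x)) := by
      rw [hD, ← mulVec_mulVec]
      exact mulVec_dotProduct_self_le D _
    have hn : ∀ v : n → ℝ, 0 ≤ v ⬝ᵥ v := fun v => by simpa using dotProduct_star_self_nonneg v
    calc ε * ((A *ᵥ x) ⬝ᵥ (A *ᵥ x)) ≤ (c + 1)⁻¹ * ((c + 1) * ((C *ᵥ x) ⬝ᵥ (C *ᵥ x))) :=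
          mul_le_mul hε (h1.trans (by gcongr; exacts [hn _, by linarith])) (hn _) (by positivity)
      _ = (C *ᵥ x) ⬝ᵥ (C *ᵥ x) := inv_mul_cancel_left₀ (by positivity) _

end Loewner

/-! ### Boundary values of rational matrices -/

section BoundaryValue

/-- `v` is the limit of `f(jω)` as the frequency `ω` tends to `l`. -/
def HasScalarValueAlong (l : Filter ℝ) (f : RatFunc ℝ) (v : ℂ) : Prop :=
  Tendsto (fun ω : ℝ => f.eval (algebraMap ℝ ℂ) (Complex.I * (ω : ℂ))) l (𝓝 v)

lemma eventually_denom_ne_zero {l : Filter ℝ} (hl : l ≤ cofinite) (f : RatFunc ℝ) :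
    ∀ᶠ ω : ℝ in l, f.denom.eval₂ (algebraMap ℝ ℂ) (Complex.I * (ω : ℂ)) ≠ 0 := by
  refine hl ?_
  have hfin : (f.denom.map (algebraMap ℝ ℂ)).rootSet ℂ |>.Finite := Polynomial.rootSet_finite _ _
  have hinj : Function.Injective fun ω : ℝ => Complex.I * (ω : ℂ) := fun a b hab => by
    simpa using hab
  refine (hfin.preimage hinj.injOn).subset fun ω hω => ?_
  have h0 : f.denom.map (algebraMap ℝ ℂ) ≠ 0 :=
    (Polynomial.map_ne_zero_iff (algebraMap ℝ ℂ).injective).2 f.denom_ne_zero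
  simpa [Polynomial.mem_rootSet, h0, Polynomial.eval₂_eq_eval_map] using hω

namespace HasScalarValueAlong

variable {l : Filter ℝ} {f g : RatFunc ℝ} {v w : ℂ}

lemma const (l : Filter ℝ) (c : ℝ) : HasScalarValueAlong l (RatFunc.C c) c := by
  simpa [HasScalarValueAlong, RatFunc.eval_C] using tendsto_const_nhds

lemma add (hl : l ≤ cofinite) (hf : HasScalarValueAlong l f v) (hg : HasScalarValueAlong l g w) :
    HasScalarValueAlong l (f + g) (v + w) := by
  refine (Tendsto.add hf hg).congr' ?_
  filter_upwards [eventually_denom_ne_zero hl f, eventually_denom_ne_zero hl g] with ω h1 h2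
  exact (RatFunc.eval_add _ _ h1 h2).symm

lemma mul (hl : l ≤ cofinite) (hf : HasScalarValueAlong l f v) (hg : HasScalarValueAlong l g w) :
    HasScalarValueAlong l (f * g) (v * w) := by
  refine (Tendsto.mul hf hg).congr' ?_
  filter_upwards [eventually_denom_ne_zero hl f, eventually_denom_ne_zero hl g] with ω h1 h2
  exact (RatFunc.eval_mul _ _ h1 h2).symm

lemma sum (hl : l ≤ cofinite) {ι : Type*} (s : Finset ι) {f : ι → RatFunc ℝ} {v : ι → ℂ}
    (h : ∀ i ∈ s, HasScalarValueAlong l (f i) (v i)) :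
    HasScalarValueAlong l (∑ i ∈ s, f i) (∑ i ∈ s, v i) := by
  classical
  induction s using Finset.induction_on with
  | empty => simpa using const l 0
  | insert a s ha ih =>
    rw [Finset.sum_insert ha, Finset.sum_insert ha]
    exact (h a (Finset.mem_insert_self a s)).add hl
      (ih fun i hi => h i (Finset.mem_insert_of_mem hi))

end HasScalarValueAlong

/-- `V` is the entrywise limit of `M(jω)` as the frequency `ω` tends to `l`. -/
def HasValueAlong {m n : Type*} (l : Filter ℝ) (M : Matrix m n (RatFunc ℝ)) (V : Matrix m n ℂ) :
    Prop :=
  ∀ i j, HasScalarValueAlong l (M i j) (V i j)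

namespace HasValueAlong

variable {k m n : Type*} {l : Filter ℝ}

lemma static (l : Filter ℝ) (T : Matrix m n ℝ) :
    HasValueAlong l (static T) (T.map Complex.ofReal) :=
  fun i j => HasScalarValueAlong.const l (T i j)

lemma one [DecidableEq n] (l : Filter ℝ) :
    HasValueAlong l (1 : Matrix n n (RatFunc ℝ)) (1 : Matrix n n ℂ) := by
  intro i j
  obtain rfl | hij := eq_or_ne i j
  · simpa using HasScalarValueAlong.const l 1
  · simpa [hij] using HasScalarValueAlong.const l 0

lemma add (hl : l ≤ cofinite) {M N : Matrix m n (RatFunc ℝ)} {V W : Matrix m n ℂ}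
    (hM : HasValueAlong l M V) (hN : HasValueAlong l N W) : HasValueAlong l (M + N) (V + W) :=
  fun i j => (hM i j).add hl (hN i j)

lemma mul [Fintype m] (hl : l ≤ cofinite) {M : Matrix k m (RatFunc ℝ)}
    {N : Matrix m n (RatFunc ℝ)} {V : Matrix k m ℂ} {W : Matrix m n ℂ}
    (hM : HasValueAlong l M V) (hN : HasValueAlong l N W) : HasValueAlong l (M * N) (V * W) :=
  fun i j => by
    rw [mul_apply, mul_apply]
    exact HasScalarValueAlong.sum hl _ fun r _ => (hM i r).mul hl (hN r j)

lemma unique [l.NeBot] {M : Matrix m n (RatFunc ℝ)} {V W : Matrix m n ℂ}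
    (hV : HasValueAlong l M V) (hW : HasValueAlong l M W) : V = W :=
  Matrix.ext fun i j => tendsto_nhds_unique (hV i j) (hW i j)

end HasValueAlong

/-- The frequencies `0` and `∞` are approached along filters that avoid every finite set of poles,
which makes the values there compatible with sums and products of rational functions. -/
lemma exists_filter_hasValueAlong {ω : ℝ≥0∞} (hω : ω ∈ ({0, ∞} : Set ℝ≥0∞)) :
    ∃ l : Filter ℝ, l ≤ cofinite ∧ l.NeBot ∧
      ∀ {m n : Type} (M : Matrix m n (RatFunc ℝ)), IsRHInf M → HasValueAlong l M (valueAt M ω) := by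
  obtain rfl | rfl : ω = 0 ∨ ω = ∞ := hω
  · refine ⟨𝓝[≠] 0, nhdsNE_le_cofinite 0, inferInstance, fun M hM i j => ?_⟩
    have hd : (M i j).denom.eval₂ (algebraMap ℝ ℂ) (Complex.I * ((0 : ℝ) : ℂ)) ≠ 0 :=
      (hM i j).2 _ (by simp)
    have hc : ∀ p : Polynomial ℝ,
        Continuous fun ω : ℝ => p.eval₂ (algebraMap ℝ ℂ) (Complex.I * (ω : ℂ)) := fun p =>
      (p.continuous_eval₂ _).comp (continuous_const.mul Complex.continuous_ofReal)
    have hval : valueAt M 0 i j =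
        (M i j).eval (algebraMap ℝ ℂ) (Complex.I * ((0 : ℝ) : ℂ)) := by
      simp [valueAt, scalarAt]
    rw [hval]
    exact (((hc _).tendsto 0).div ((hc _).tendsto 0) hd).mono_left nhdsWithin_le_nhds
  · exact ⟨atTop, atTop_le_cofinite, inferInstance,
      fun M hM i j => tendsto_scalarAt_top (M i j) (hM i j).1⟩

lemma exists_real_valueAt {m n : Type*} (M : Matrix m n (RatFunc ℝ)) {ω : ℝ≥0∞}
    (hω : ω ∈ ({0, ∞} : Set ℝ≥0∞)) :
    ∃ A : Matrix m n ℝ, valueAt M ω = A.map Complex.ofReal := by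
  suffices H : ∀ f : RatFunc ℝ, ∃ a : ℝ, scalarAt f ω = a by
    choose a ha using H
    exact ⟨M.map a, Matrix.ext fun i j => ha (M i j)⟩
  intro f
  obtain rfl | rfl : ω = 0 ∨ ω = ∞ := hω
  · refine ⟨f.num.coeff 0 / f.denom.coeff 0, ?_⟩
    simp [scalarAt, RatFunc.eval, Polynomial.eval₂_at_zero]
  · exact ⟨_, by rw [scalarAt, if_pos rfl]⟩

/-- Stability of the loop with scalings `1` and `Uᵀ` makes the return difference at the boundary
frequency invertible, because its inverse has a value there too. -/
lemma isUnit_one_add_of_stable {n : ℕ} {G K : Matrix (Fin n) (Fin n) (RatFunc ℝ)}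
    (hG : IsRHInf G) (hK : IsRHInf K)
    (hstab : ∀ T S : Matrix (Fin n) (Fin n) ℝ, IsUnit T → IsUnit S →
      HasRHInfInverse (1 + (static T.transpose * G * static T) *
        (static S.transpose * K * static S)))
    {ω : ℝ≥0∞} (hω : ω ∈ ({0, ∞} : Set ℝ≥0∞)) {A B : Matrix (Fin n) (Fin n) ℝ}
    (hA : valueAt G ω = A.map Complex.ofReal) (hB : valueAt K ω = B.map Complex.ofReal)
    {U : Matrix (Fin n) (Fin n) ℝ} (hU : IsUnit U) : IsUnit (1 + A * U * B * Uᵀ) := by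
  obtain ⟨l, hl, hne, hval⟩ := exists_filter_hasValueAlong hω
  obtain ⟨hunit, hinv⟩ := hstab 1 Uᵀ isUnit_one ((isUnit_transpose U).2 hU)
  set R := 1 + (static (1 : Matrix (Fin n) (Fin n) ℝ)ᵀ * G * static 1) *
    (static Uᵀᵀ * K * static Uᵀ)
  have hR := (HasValueAlong.one (n := Fin n) l).add hl
    ((((HasValueAlong.static l 1ᵀ).mul hl (hval G hG)).mul hl (HasValueAlong.static l 1)).mul hl
      (((HasValueAlong.static l Uᵀᵀ).mul hl (hval K hK)).mul hl (HasValueAlong.static l Uᵀ)))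
  have hprod := hR.mul hl (hval _ hinv)
  rw [mul_nonsing_inv _ ((isUnit_iff_isUnit_det _).1 hunit)] at hprod
  have hone := hprod.unique (HasValueAlong.one l)
  have hmap : ∀ X Y : Matrix (Fin n) (Fin n) ℝ,
      X.map Complex.ofReal * Y.map Complex.ofReal = (X * Y).map Complex.ofReal := fun X Y =>
    (Matrix.map_mul (f := Complex.ofRealHom)).symm
  have hmapone : (1 : Matrix (Fin n) (Fin n) ℂ) =
      (1 : Matrix (Fin n) (Fin n) ℝ).map Complex.ofReal :=
    (Matrix.map_one _ Complex.ofReal_zero Complex.ofReal_one).symm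
  have hdet := isUnit_det_of_right_inverse hone
  rw [hA, hB, hmap, hmap, hmap, hmap, hmap, hmapone,
    ← Matrix.map_add _ Complex.ofReal_add] at hdet
  rw [isUnit_iff_isUnit_det, isUnit_iff_ne_zero]
  have hd := Complex.ofRealHom.map_det
    (1 + 1ᵀ * A * 1 * (Uᵀᵀ * B * Uᵀ))
  rw [RingHom.mapMatrix_apply] at hd
  intro h0
  refine hdet.ne_zero (hd.symm.trans ?_)
  rw [transpose_one, one_mul, mul_one, transpose_transpose, ← Matrix.mul_assoc, ← Matrix.mul_assoc,
    h0, map_zero]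

end BoundaryValue

/-! ### The multiplier inequalities -/

section Multiplier

variable {n : Type*} [Fintype n] [DecidableEq n]

lemma graphForm_passivityMultiplier (A : Matrix n n ℂ) :
    graphForm (passivityMultiplier n) A = -(A + Aᴴ) := by
  simp [graphForm, passivityMultiplier, fromCols_mul_fromBlocks, fromCols_mul_fromRows]

lemma inverseGraphForm_passivityMultiplier (B : Matrix n n ℂ) :
    inverseGraphForm (passivityMultiplier n) B = B + Bᴴ := by
  simp [inverseGraphForm, passivityMultiplier, fromCols_mul_fromBlocks, fromCols_mul_fromRows]

lemma graphForm_neg (P : Matrix (n ⊕ n) (n ⊕ n) ℂ) (A : Matrix n n ℂ) :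
    graphForm (-P) A = -graphForm P A := by
  simp only [graphForm, Matrix.mul_neg, Matrix.neg_mul]

lemma inverseGraphForm_neg (P : Matrix (n ⊕ n) (n ⊕ n) ℂ) (B : Matrix n n ℂ) :
    inverseGraphForm (-P) B = -inverseGraphForm P B := by
  simp only [inverseGraphForm, Matrix.mul_neg, Matrix.neg_mul]

/-- The pair of quadratic inequalities separating the graph of `-A` from the inverse graph of `B`
with margin `ε`, on one side or the other. -/
def SeparatedBy (P : Matrix (n ⊕ n) (n ⊕ n) ℂ) (A B : Matrix n n ℂ) (ε : ℝ) : Prop :=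
  (LoewnerLE (graphForm P A) (-(ε • (Aᴴ * A))) ∧ LoewnerLE 0 (inverseGraphForm P B)) ∨
    (LoewnerLE (graphForm P A) 0 ∧ LoewnerLE (ε • (Bᴴ * B)) (inverseGraphForm P B))

lemma SeparatedBy.of_neg_neg {A B : Matrix n n ℂ} {ε : ℝ}
    (h : SeparatedBy (passivityMultiplier n) (-A) (-B) ε) :
    SeparatedBy (-passivityMultiplier n) A B ε := by
  simp only [SeparatedBy, graphForm_neg, inverseGraphForm_neg, graphForm_passivityMultiplier,
    inverseGraphForm_passivityMultiplier, conjTranspose_neg, neg_mul_neg, ← neg_add] at h ⊢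
  exact h

lemma exists_separatedBy_of_formNonneg {A B : Matrix n n ℝ} (hA : FormNonneg A)
    (hB : FormNonneg B) (hd : FormDefinite A ∨ FormDefinite B) :
    ∃ ε₀ : ℝ, 0 < ε₀ ∧ ∀ ε, ε ≤ ε₀ →
      SeparatedBy (passivityMultiplier n) (A.map Complex.ofReal) (B.map Complex.ofReal) ε := by
  have hnonneg : ∀ {M : Matrix n n ℝ}, FormNonneg M →
      (M.map Complex.ofReal + (M.map Complex.ofReal)ᴴ).PosSemidef := fun {M} hM => by
    simpa using posSemidef_sub_map_ofReal (A := M) (ε := 0) (by simpa using hM.posSemidef)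
  simp only [SeparatedBy, LoewnerLE, graphForm_passivityMultiplier,
    inverseGraphForm_passivityMultiplier, sub_neg_eq_add, sub_zero, neg_add_eq_sub,
    zero_add]
  obtain hd | hd := hd
  · obtain ⟨ε₀, h0, h⟩ := exists_posSemidef_sub hA hd
    exact ⟨ε₀, h0, fun ε hε => Or.inl ⟨posSemidef_sub_map_ofReal (h ε hε), hnonneg hB⟩⟩
  · obtain ⟨ε₀, h0, h⟩ := exists_posSemidef_sub hB hd
    exact ⟨ε₀, h0, fun ε hε => Or.inr ⟨hnonneg hA, posSemidef_sub_map_ofReal (h ε hε)⟩⟩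

theorem exists_separatedBy {A B : Matrix n n ℝ} (hA : A ≠ 0) (hB : B ≠ 0)
    (h : ∀ U : Matrix n n ℝ, IsUnit U → IsUnit (1 + A * U * B * Uᵀ)) :
    ∃ ε₀ : ℝ, 0 < ε₀ ∧ ∀ ε, ε ≤ ε₀ → ∃ P : Matrix (n ⊕ n) (n ⊕ n) ℂ,
      (P = passivityMultiplier n ∨ P = -passivityMultiplier n) ∧
        SeparatedBy P (A.map Complex.ofReal) (B.map Complex.ofReal) ε := by
  obtain ⟨⟨hAn, hBn⟩ | ⟨hAn, hBn⟩, hd⟩ :=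
    forms_semidefinite hA hB fun y w hy hw => add_dotProduct_mulVec_ne_zero h hy hw
  · obtain ⟨ε₀, h0, hs⟩ := exists_separatedBy_of_formNonneg hAn hBn hd
    exact ⟨ε₀, h0, fun ε hε => ⟨_, Or.inl rfl, hs ε hε⟩⟩
  · have hneg : ∀ {M : Matrix n n ℝ}, FormDefinite M → FormDefinite (-M) := fun hM x hx => by
      rw [neg_mulVec, neg_eq_zero]
      exact hM x (by simpa [neg_mulVec] using hx)
    obtain ⟨ε₀, h0, hs⟩ := exists_separatedBy_of_formNonneg hAn hBn (hd.imp hneg hneg)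
    refine ⟨ε₀, h0, fun ε hε => ⟨_, Or.inr rfl, SeparatedBy.of_neg_neg ?_⟩⟩
    have hmap : ∀ M : Matrix n n ℝ, (-M).map Complex.ofReal = -M.map Complex.ofReal := fun M => by
      ext i j; simp
    simpa only [hmap] using hs ε hε

end Multiplier

end PhaseMultiplier

theorem mainTheorem10 (n : ℕ) (G K : Matrix (Fin n) (Fin n) (RatFunc ℝ))
    (hG : PhaseMultiplier.IsRHInf G) (hK : PhaseMultiplier.IsRHInf K)
    (hstab : ∀ T S : Matrix (Fin n) (Fin n) ℝ, IsUnit T → IsUnit S →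
      PhaseMultiplier.HasRHInfInverse
        (1 + (PhaseMultiplier.static T.transpose * G * PhaseMultiplier.static T) *
          (PhaseMultiplier.static S.transpose * K * PhaseMultiplier.static S))) :
    ∃ ε : ℝ, 0 < ε ∧ ∀ ω ∈ ({0, ∞} : Set ℝ≥0∞),
      PhaseMultiplier.valueAt G ω ≠ 0 → PhaseMultiplier.valueAt K ω ≠ 0 →
      ∃ P : Matrix (Fin n ⊕ Fin n) (Fin n ⊕ Fin n) ℂ,
        (P = PhaseMultiplier.passivityMultiplier (Fin n) ∨
          P = -PhaseMultiplier.passivityMultiplier (Fin n)) ∧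
        ((PhaseMultiplier.LoewnerLE
              (PhaseMultiplier.graphForm P (PhaseMultiplier.valueAt G ω))
              (-(ε • ((PhaseMultiplier.valueAt G ω).conjTranspose *
                PhaseMultiplier.valueAt G ω))) ∧
            PhaseMultiplier.LoewnerLE 0
              (PhaseMultiplier.inverseGraphForm P (PhaseMultiplier.valueAt K ω))) ∨
          (PhaseMultiplier.LoewnerLE
              (PhaseMultiplier.graphForm P (PhaseMultiplier.valueAt G ω)) 0 ∧
            PhaseMultiplier.LoewnerLE
              (ε • ((PhaseMultiplier.valueAt K ω).conjTranspose *
                PhaseMultiplier.valueAt K ω))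
              (PhaseMultiplier.inverseGraphForm P (PhaseMultiplier.valueAt K ω)))) := by
  have key : ∀ ω ∈ ({0, ∞} : Set ℝ≥0∞), ∃ ε₀ : ℝ, 0 < ε₀ ∧ ∀ ε, ε ≤ ε₀ →
      PhaseMultiplier.valueAt G ω ≠ 0 → PhaseMultiplier.valueAt K ω ≠ 0 →
      ∃ P : Matrix (Fin n ⊕ Fin n) (Fin n ⊕ Fin n) ℂ,
        (P = PhaseMultiplier.passivityMultiplier (Fin n) ∨
          P = -PhaseMultiplier.passivityMultiplier (Fin n)) ∧
        PhaseMultiplier.SeparatedBy P (PhaseMultiplier.valueAt G ω)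
          (PhaseMultiplier.valueAt K ω) ε := by
    intro ω hω
    by_cases hne : PhaseMultiplier.valueAt G ω ≠ 0 ∧ PhaseMultiplier.valueAt K ω ≠ 0
    · obtain ⟨A, hA⟩ := PhaseMultiplier.exists_real_valueAt G hω
      obtain ⟨B, hB⟩ := PhaseMultiplier.exists_real_valueAt K hω
      obtain ⟨ε₀, h0, h⟩ := PhaseMultiplier.exists_separatedBy (A := A) (B := B)
        (by rintro rfl; exact hne.1 (by rw [hA]; ext; simp))
        (by rintro rfl; exact hne.2 (by rw [hB]; ext; simp))
        fun U hU => PhaseMultiplier.isUnit_one_add_of_stable hG hK hstab hω hA hB hU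
      exact ⟨ε₀, h0, fun ε hε _ _ => by rw [hA, hB]; exact h ε hε⟩
    · exact ⟨1, one_pos, fun _ _ h1 h2 => absurd ⟨h1, h2⟩ hne⟩
  obtain ⟨ε₁, h1, H1⟩ := key 0 (Or.inl rfl)
  obtain ⟨ε₂, h2, H2⟩ := key ∞ (Or.inr rfl)
  refine ⟨min ε₁ ε₂, lt_min h1 h2, fun ω hω => ?_⟩
  obtain rfl | rfl : ω = 0 ∨ ω = ∞ := hω
  · exact H1 _ (min_le_left _ _)
  · exact H2 _ (min_le_right _ _)
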